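/- Let $X$ be a real normed space of finite dimension $d$ and let $S$ be a finite set with $|S| \ge d+1$. Write $X^S$ for the space of placements $p = (p_v)_{v\in S}$, $p_v \in X$, with the product topology. Let $\mathrm{Iso}(X)$ be the group of isometries of $X$; by the Mazur--Ulam theorem all isometries are affine, and $\mathrm{Iso}(X)$ is a closed smooth submanifold (a Lie group) of the normed space $A(X)$ of affine maps $X \to X$. For $p \in X^S$ put $g.p := (g(p_v))_{v\in S}$, and let $\mathcal{O}_p := \{g.p : g \in \mathrm{Iso}(X)\}$ be the orbit of $p$, which is a closed smooth submanifold of $X^S$. A placement $p$ is called full if the orbit map $\phi_p : \mathrm{Iso}(X) \to \mathcal{O}_p$, $g \mapsto g.p$, is a smooth local diffeomorphism. Then the set $\mathrm{Full}(S) \subseteq X^S$ of full placements of $S$ is open and dense in $X^S$, and its complement $X^S \setminus \mathrm{Full}(S)$ has measure zero with respect to the Lebesgue measure on $X^S$. -/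

import Mathlib

open scoped ContDiff

section SmoothMaps

variable {E F : Type*} [NormedAddCommGroup E] [NormedSpace ℝ E]
  [NormedAddCommGroup F] [NormedSpace ℝ F]

/-- Smoothness of a map on a subset `A` of a normed space (typically an embedded submanifold):
around each point of `A`, the restriction of `f` to `A` extends to a smooth map on an open
neighbourhood in the ambient space. Only the values of `f` on `A` matter. On embedded
submanifolds this is smoothness in charts. -/
def SmoothOnSubset (f : E → F) (A : Set E) : Prop :=
  ∀ x ∈ A, ∃ U : Set E, IsOpen U ∧ x ∈ U ∧
    ∃ f' : E → F, ContDiffOn ℝ ∞ f' U ∧ Set.EqOn f' f (A ∩ U)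

/-- `f` restricts to a smooth diffeomorphism from `A` onto `B`: a smooth bijection with smooth
inverse. -/
def IsDiffeoBetween (f : E → F) (A : Set E) (B : Set F) : Prop :=
  Set.MapsTo f A B ∧ SmoothOnSubset f A ∧
    ∃ g : F → E, Set.MapsTo g B A ∧ SmoothOnSubset g B ∧ Set.InvOn g f A B

/-- `f` restricts to a smooth local diffeomorphism `M → N`: it maps `M` to `N`, and each point
of `M` has a relatively open neighbourhood `M ∩ U` in `M` which `f` maps diffeomorphically onto
a relatively open subset `N ∩ V` of `N`. -/
def IsLocalDiffeoBetween (f : E → F) (M : Set E) (N : Set F) : Prop :=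
  Set.MapsTo f M N ∧
    ∀ x ∈ M, ∃ U : Set E, ∃ V : Set F, IsOpen U ∧ x ∈ U ∧ IsOpen V ∧
      IsDiffeoBetween f (M ∩ U) (N ∩ V)

end SmoothMaps

section Placements

variable {X : Type*} [NormedAddCommGroup X] [NormedSpace ℝ X] {S : Type*}

/-- An isometry of a real normed space, which is affine by the Mazur-Ulam theorem, viewed as an
element of the normed space `A(X)` of continuous affine self-maps of `X`. -/
noncomputable def isometryToAffine (h : X ≃ᵢ X) : X →ᴬ[ℝ] X where
  toAffineMap := h.toRealAffineIsometryEquiv.toAffineEquiv.toAffineMap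
  cont := h.continuous

/-- The isometry group `Iso(X)`, as a subset of the normed space `A(X)`. -/
def isoSet (X : Type*) [NormedAddCommGroup X] [NormedSpace ℝ X] : Set (X →ᴬ[ℝ] X) :=
  Set.range (isometryToAffine (X := X))

/-- `g.p = (g(p_v))_{v ∈ S}` for an affine map `g` and a placement `p`. Restricted to `Iso(X)`,
this is the orbit map `φ_p`. -/
def orbitMap (p : S → X) (g : X →ᴬ[ℝ] X) : S → X := fun v => g (p v)

/-- The orbit `O_p` of a placement `p` under `Iso(X)`. -/
def placementOrbit (p : S → X) : Set (S → X) := orbitMap p '' isoSet X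

/-- A placement `p` of a finite set is full if `φ_p : Iso(X) → O_p` is a smooth local
diffeomorphism. Here `Iso(X)` and `O_p` carry the smooth structures of (closed) submanifolds of
`A(X)` and of `X^S`. -/
def IsFullPlacement [Fintype S] (p : S → X) : Prop :=
  IsLocalDiffeoBetween (orbitMap p) (isoSet X) (placementOrbit p)

/-- The set `Full(S) ⊆ X^S` of full placements. -/
def fullPlacements (S : Type*) [Fintype S] (X : Type*) [NormedAddCommGroup X]
    [NormedSpace ℝ X] : Set (S → X) :=
  {p | IsFullPlacement p}

end Placements

open Set Filter Topology

/-! ### Smooth local left inverses -/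

section LeftInverse

variable {E : Type*} [NormedAddCommGroup E] [NormedSpace ℝ E] [CompleteSpace E]

/-! Fullness of `p` amounts to one local datum, `HasSmoothOrbitSection`: a smooth map on a
neighbourhood of `p` recovering `g` from `g.p` for isometries `g` near the identity. Group
translation carries it to every other isometry, and compactness makes the orbit map open onto the
orbit, so no manifold theory is needed. The datum survives perturbation of `p` by the inverse
function theorem, so full placements form an open set.

If `p` affinely spans `X`, then `g ↦ g.p` is linear and injective on all of `A(X)`, and a linear
left inverse is a section. On each line in a suitable fixed direction spanning fails for only
finitely many parameters, so almost every placement is full; density follows. -/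

/-- A smooth map with invertible derivative at `x` has a left inverse near `x` that is smooth on a
neighbourhood of the image of `x`. -/
theorem exists_smooth_local_leftInverse {H : E → E} {U : Set E} (hU : IsOpen U)
    (hH : ContDiffOn ℝ ∞ H U) {x : E} (hx : x ∈ U) (hunit : IsUnit (fderiv ℝ H x)) :
    ∃ W : Set E, IsOpen W ∧ H x ∈ W ∧ ∃ G : E → E, ContDiffOn ℝ ∞ G W ∧ MapsTo G W U ∧
      ∀ᶠ z in 𝓝 x, G (H z) = z := by
  -- The derivative is invertible throughout `O`, which makes the inverse smooth on an open set and
  -- not only at `H x`.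
  set O : Set E := U ∩ fderiv ℝ H ⁻¹' {A | IsUnit A} with hO
  have hOo : IsOpen O :=
    (hH.continuousOn_fderiv_of_isOpen hU (by simp)).isOpen_inter_preimage hU Units.isOpen
  have hcd : ∀ z ∈ U, ContDiffAt ℝ ∞ H z := fun z hz => hH.contDiffAt (hU.mem_nhds hz)
  have hder : ∀ z ∈ O, ∃ A : E ≃L[ℝ] E, HasFDerivAt H (A : E →L[ℝ] E) z := by
    rintro z ⟨hzU, u, hu⟩
    refine ⟨ContinuousLinearEquiv.unitsEquiv ℝ E u, ?_⟩
    have h1 : ((ContinuousLinearEquiv.unitsEquiv ℝ E u : E ≃L[ℝ] E) : E →L[ℝ] E)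
        = fderiv ℝ H z := by
      rw [← hu]; ext y; simp
    rw [h1]
    exact ((hcd z hzU).differentiableAt (by simp)).hasFDerivAt
  obtain ⟨A, hA⟩ := hder x ⟨hx, hunit⟩
  have hn : (∞ : WithTop ℕ∞) ≠ 0 := by simp
  set e := (hcd x hx).toOpenPartialHomeomorph H hA hn with he
  have hxs : x ∈ e.source := ContDiffAt.mem_toOpenPartialHomeomorph_source _ _ hn
  have heH : ∀ z, e z = H z := fun z => rfl
  refine ⟨e.target ∩ e.symm ⁻¹' O, e.symm.isOpen_inter_preimage hOo, ?_, e.symm, ?_, ?_, ?_⟩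
  · refine ⟨e.map_source hxs, ?_⟩
    have : e.symm (H x) = x := e.left_inv hxs
    rw [mem_preimage, this]
    exact ⟨hx, hunit⟩
  · rintro y ⟨hyt, hyO⟩
    obtain ⟨B, hB⟩ := hder _ hyO
    exact (e.contDiffAt_symm hyt hB (hcd _ hyO.1)).contDiffWithinAt
  · exact fun y hy => hy.2.1
  · filter_upwards [e.open_source.mem_nhds hxs] with z hz
    exact e.left_inv hz

end LeftInverse

/-! ### The isometry group inside the space of affine maps -/

section IsometryGroup

variable {X : Type*} [NormedAddCommGroup X] [NormedSpace ℝ X]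

@[simp]
theorem isometryToAffine_apply (h : X ≃ᵢ X) (x : X) : isometryToAffine h x = h x := rfl

theorem id_mem_isoSet : ContinuousAffineMap.id ℝ X ∈ isoSet X :=
  ⟨IsometryEquiv.refl X, by ext x; rfl⟩

theorem comp_mem_isoSet {g h : X →ᴬ[ℝ] X} (hg : g ∈ isoSet X) (hh : h ∈ isoSet X) :
    g.comp h ∈ isoSet X := by
  obtain ⟨a, rfl⟩ := hg
  obtain ⟨b, rfl⟩ := hh
  exact ⟨b.trans a, by ext x; rfl⟩

theorem exists_inverse_mem_isoSet {g : X →ᴬ[ℝ] X} (hg : g ∈ isoSet X) :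
    ∃ k ∈ isoSet X, g.comp k = ContinuousAffineMap.id ℝ X ∧
      k.comp g = ContinuousAffineMap.id ℝ X := by
  obtain ⟨a, rfl⟩ := hg
  exact ⟨_, ⟨a.symm, rfl⟩, by ext x; simp, by ext x; simp⟩

theorem isometry_of_mem_isoSet {g : X →ᴬ[ℝ] X} (hg : g ∈ isoSet X) : Isometry g := by
  obtain ⟨a, rfl⟩ := hg
  exact a.isometry

instance [FiniteDimensional ℝ X] : FiniteDimensional ℝ (X →ᴬ[ℝ] X) :=
  (ContinuousAffineMap.decompLinearEquiv ℝ ℝ X X).symm.finiteDimensional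

theorem contLinear_norm_map_of_isometry {g : X →ᴬ[ℝ] X} (hg : Isometry g) (x : X) :
    ‖g.contLinear x‖ = ‖x‖ := by
  have h := g.contLinear_map_vsub x 0
  have h2 := hg.dist_eq x 0
  simp only [vsub_eq_sub, sub_zero] at h
  rw [h, ← dist_eq_norm, h2, dist_zero_right]

variable [FiniteDimensional ℝ X]

/-- The linear part preserves norms, so it is injective, and in finite dimension surjective. -/
theorem mem_isoSet_iff_isometry {g : X →ᴬ[ℝ] X} : g ∈ isoSet X ↔ Isometry g := by
  refine ⟨isometry_of_mem_isoSet, fun hg => ?_⟩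
  have hinj : Function.Injective (g.contLinear : X →ₗ[ℝ] X) := by
    refine (injective_iff_map_eq_zero _).2 fun x hx => ?_
    rw [← norm_eq_zero, ← contLinear_norm_map_of_isometry hg x]
    simpa using hx
  have hsurj : Function.Surjective g := fun y => by
    obtain ⟨x, hx⟩ := LinearMap.injective_iff_surjective.1 hinj (y - g 0)
    refine ⟨x, ?_⟩
    have h := g.contLinear_map_vsub x 0
    have hx' : g.contLinear x = y - g 0 := hx
    simp only [vsub_eq_sub, sub_zero, hx'] at h
    exact (sub_left_inj.1 h).symm
  exact ⟨⟨Equiv.ofBijective g ⟨hg.injective, hsurj⟩, hg⟩, by ext x; rfl⟩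

/-- Evaluation of affine maps at all points of a placement, as a continuous linear map. -/
noncomputable def orbitCLM {S : Type*} [Fintype S] (p : S → X) :
    (X →ᴬ[ℝ] X) →L[ℝ] (S → X) :=
  LinearMap.toContinuousLinearMap
    { toFun := orbitMap p
      map_add' := fun _ _ => rfl
      map_smul' := fun _ _ => rfl }

theorem continuous_eval_affine (x : X) : Continuous fun g : X →ᴬ[ℝ] X => g x :=
  (continuous_apply ()).comp (orbitCLM fun _ : Unit => x).continuous

theorem isClosed_isoSet : IsClosed (isoSet X) := by
  have : isoSet X = ⋂ x, ⋂ y, {g : X →ᴬ[ℝ] X | dist (g x) (g y) = dist x y} := by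
    ext g
    simp [mem_isoSet_iff_isometry, isometry_iff_dist_eq]
  rw [this]
  exact isClosed_iInter fun x => isClosed_iInter fun y =>
    isClosed_eq ((continuous_eval_affine x).dist (continuous_eval_affine y)) continuous_const

-- Linear parts of isometries have norm at most one, so bounding the value at one point bounds the
-- whole map. With closedness this gives compactness.
omit [FiniteDimensional ℝ X] in
theorem isBounded_isometries_of_bound (x : X) (R : ℝ) :
    Bornology.IsBounded (isoSet X ∩ {g | ‖g x‖ ≤ R}) := by
  refine isBounded_iff_forall_norm_le.2 ⟨max (‖x‖ + R) 1, ?_⟩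
  rintro g ⟨hg, hgx⟩
  have hgi := isometry_of_mem_isoSet hg
  rw [ContinuousAffineMap.norm_def]
  refine max_le_max ?_ ?_
  · have h := hgi.dist_eq 0 x
    rw [dist_eq_norm, dist_zero_left] at h
    have := norm_le_norm_add_norm_sub' (g 0) (g x)
    have hgx' : ‖g x‖ ≤ R := hgx
    linarith
  · exact ContinuousLinearMap.opNorm_le_bound _ zero_le_one fun y => by
      rw [contLinear_norm_map_of_isometry hgi, one_mul]

theorem continuous_comp_right (h : X →ᴬ[ℝ] X) : Continuous fun k : X →ᴬ[ℝ] X => k.comp h :=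
  LinearMap.continuous_of_finiteDimensional
    ({ toFun := fun k => k.comp h
       map_add' := fun _ _ => rfl
       map_smul' := fun _ _ => rfl } : (X →ᴬ[ℝ] X) →ₗ[ℝ] (X →ᴬ[ℝ] X))

theorem contDiff_comp_left (h : X →ᴬ[ℝ] X) :
    ContDiff ℝ ∞ fun k : X →ᴬ[ℝ] X => h.comp k := by
  let T : (X →ᴬ[ℝ] X) →ₗ[ℝ] (X →ᴬ[ℝ] X) :=
    { toFun := fun k => h.contLinear.toContinuousAffineMap.comp k
      map_add' := fun a b => by ext x; simp
      map_smul' := fun a b => by ext x; simp }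
  have : (fun k : X →ᴬ[ℝ] X => h.comp k) =
      fun k => T.toContinuousLinearMap k + ContinuousAffineMap.const ℝ X (h 0) := by
    funext k
    ext x
    have := congrFun h.decomp (k x)
    simpa [T] using this
  rw [this]
  exact T.toContinuousLinearMap.contDiff.add contDiff_const

end IsometryGroup

/-! ### Sections of the orbit map, openness and genericity -/

section Sections

variable {X : Type*} [NormedAddCommGroup X] [NormedSpace ℝ X] {S : Type*} [Fintype S]

/-- The orbit map of `p` has a smooth local section at the identity: a smooth map near `p`
recovering an isometry `g` close to the identity from `g.p`. -/
def HasSmoothOrbitSection (p : S → X) : Prop :=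
  ∃ W : Set (S → X), IsOpen W ∧ p ∈ W ∧ ∃ f : (S → X) → (X →ᴬ[ℝ] X), ContDiffOn ℝ ∞ f W ∧
    ∀ᶠ g in 𝓝[isoSet X] (ContinuousAffineMap.id ℝ X), f (orbitMap p g) = g

omit [Fintype S] in
theorem orbitMap_id (p : S → X) : orbitMap p (ContinuousAffineMap.id ℝ X) = p := rfl

omit [Fintype S] in
theorem orbitMap_comp (p : S → X) (g h : X →ᴬ[ℝ] X) :
    orbitMap p (g.comp h) = orbitMap (orbitMap p h) g := rfl

variable [FiniteDimensional ℝ X]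

theorem IsFullPlacement.hasSmoothOrbitSection {p : S → X} (hp : IsFullPlacement p) :
    HasSmoothOrbitSection p := by
  obtain ⟨U, V, hU, hidU, hV, hmaps, -, k, hk, hks, hinv⟩ :=
    hp.2 (ContinuousAffineMap.id ℝ X) id_mem_isoSet
  obtain ⟨W, hW, hpW, f, hf, heq⟩ := hks p (hmaps ⟨id_mem_isoSet, hidU⟩)
  refine ⟨W, hW, hpW, f, hf, ?_⟩
  have hcont : Continuous (orbitMap (X := X) p) := (orbitCLM p).continuous
  filter_upwards [self_mem_nhdsWithin, mem_nhdsWithin_of_mem_nhds (hU.mem_nhds hidU),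
    mem_nhdsWithin_of_mem_nhds ((hW.preimage hcont).mem_nhds hpW)] with g hg hgU hgW
  rw [heq ⟨hmaps ⟨hg, hgU⟩, hgW⟩, hinv.1 ⟨hg, hgU⟩]

/-- The orbit map is open onto the orbit. -/
theorem exists_open_orbit_inter_subset [Nonempty S] (p : S → X) {g₀ : X →ᴬ[ℝ] X}
    {U : Set (X →ᴬ[ℝ] X)} (hU : IsOpen U) (hg₀ : g₀ ∈ isoSet X) (hg₀U : g₀ ∈ U) :
    ∃ V : Set (S → X), IsOpen V ∧ orbitMap p g₀ ∈ V ∧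
      placementOrbit p ∩ V ⊆ orbitMap p '' (isoSet X ∩ U) := by
  have hcont : Continuous (orbitMap (X := X) p) := (orbitCLM p).continuous
  obtain ⟨v⟩ := ‹Nonempty S›
  -- Isometries that a stabilizer element of `p`, composed on the right, brings into `U`; this does
  -- not change `g.p`. The remaining ones of bounded value form a compact set whose image misses
  -- `g₀.p`.
  set O : Set (X →ᴬ[ℝ] X) :=
    ⋃ h ∈ {h : X →ᴬ[ℝ] X | h ∈ isoSet X ∧ orbitMap p h = p}, (fun k => k.comp h) ⁻¹' U with hO
  have hOo : IsOpen O :=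
    isOpen_biUnion fun h _ => hU.preimage (continuous_comp_right h)
  set R := ‖g₀ (p v)‖ + 1 with hR
  set C : Set (X →ᴬ[ℝ] X) := (isoSet X ∩ {g | ‖g (p v)‖ ≤ R}) \ O with hC
  have hCc : IsCompact C := by
    refine Metric.isCompact_of_isClosed_isBounded ?_
      ((isBounded_isometries_of_bound (p v) R).subset sdiff_subset)
    exact (isClosed_isoSet.inter
      (isClosed_le (continuous_eval_affine (p v)).norm continuous_const)).sdiff hOo
  refine ⟨(orbitMap p '' C)ᶜ ∩ {y | ‖y v‖ < R}, ?_, ⟨?_, ?_⟩, ?_⟩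
  · exact (hCc.image hcont).isClosed.isOpen_compl.inter
      (isOpen_lt (continuous_apply v).norm continuous_const)
  · rintro ⟨g, ⟨⟨hg, -⟩, hgO⟩, hgp⟩
    obtain ⟨k, hk, hgk, hkg⟩ := exists_inverse_mem_isoSet hg
    refine hgO (mem_biUnion (x := k.comp g₀) ⟨comp_mem_isoSet hk hg₀, ?_⟩ ?_)
    · rw [orbitMap_comp, ← hgp, ← orbitMap_comp, hkg, orbitMap_id]
    · have : g.comp (k.comp g₀) = (g.comp k).comp g₀ := rfl
      rw [mem_preimage, this, hgk]
      exact hg₀U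
  · exact lt_add_one ‖g₀ (p v)‖
  · rintro y ⟨⟨g, hg, rfl⟩, hgC, hgR⟩
    have hgO : g ∈ O := by
      by_contra hgO
      exact hgC ⟨g, ⟨⟨hg, LT.lt.le (show ‖g (p v)‖ < R from hgR)⟩, hgO⟩, rfl⟩
    simp only [hO, mem_iUnion] at hgO
    obtain ⟨h, ⟨hh, hhp⟩, hgh⟩ := hgO
    exact ⟨g.comp h, ⟨comp_mem_isoSet hg hh, hgh⟩, by rw [orbitMap_comp, hhp]⟩

/-- Near `g₀.p` the local inverse is the translated section `y ↦ g₀ ∘ f (g₀⁻¹.y)`. Openness of the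
orbit map ensures that every orbit point near `g₀.p` comes from an isometry near `g₀`. -/
theorem HasSmoothOrbitSection.isFullPlacement [Nonempty S] {p : S → X}
    (hp : HasSmoothOrbitSection p) : IsFullPlacement p := by
  obtain ⟨W, hW, hpW, f, hf, hev⟩ := hp
  have hcont (q : S → X) : Continuous (orbitMap (X := X) q) := (orbitCLM q).continuous
  have hsm (q : S → X) : ContDiff ℝ ∞ (orbitMap (X := X) q) := (orbitCLM q).contDiff
  have hact (k : X →ᴬ[ℝ] X) : ContDiff ℝ ∞ fun y : S → X => fun v => k (y v) :=
    contDiff_pi.2 fun v => k.contDiff.comp (contDiff_apply ℝ X v)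
  refine ⟨fun g hg => ⟨g, hg, rfl⟩, fun g₀ hg₀ => ?_⟩
  obtain ⟨k, hk, hgk, hkg⟩ := exists_inverse_mem_isoSet hg₀
  obtain ⟨N, hN, hidN, hNf⟩ := mem_nhdsWithin.1 hev
  set F : (S → X) → (X →ᴬ[ℝ] X) := fun y => g₀.comp (f fun v => k (y v)) with hF
  set W' : Set (S → X) := (fun y : S → X => fun v => k (y v)) ⁻¹' W with hW'
  have hW'o : IsOpen W' := hW.preimage (hact k).continuous
  have hFs : ContDiffOn ℝ ∞ F W' :=
    (contDiff_comp_left g₀).comp_contDiffOn (hf.comp (hact k).contDiffOn (mapsTo_preimage _ _))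
  set N' : Set (X →ᴬ[ℝ] X) := (fun g => k.comp g) ⁻¹' N ∩ orbitMap p ⁻¹' W' with hN'
  have hN'o : IsOpen N' :=
    (hN.preimage (contDiff_comp_left k).continuous).inter (hW'o.preimage (hcont p))
  have hg₀N' : g₀ ∈ N' := by
    refine ⟨?_, ?_⟩
    · rw [mem_preimage, hkg]; exact hidN
    · change orbitMap p (k.comp g₀) ∈ W
      rw [hkg]; exact hpW
  have hleft : ∀ g ∈ isoSet X ∩ N', F (orbitMap p g) = g := by
    rintro g ⟨hg, hgN, -⟩
    have h1 : f (orbitMap p (k.comp g)) = k.comp g := hNf ⟨hgN, comp_mem_isoSet hk hg⟩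
    have h2 : F (orbitMap p g) = g₀.comp (k.comp g) := congrArg g₀.comp h1
    have h3 : g₀.comp (k.comp g) = (g₀.comp k).comp g := rfl
    rw [h2, h3, hgk]; rfl
  obtain ⟨V, hV, hgV, hVsub⟩ := exists_open_orbit_inter_subset p hN'o hg₀ hg₀N'
  have hsurj : ∀ y ∈ placementOrbit p ∩ V,
      ∃ g ∈ isoSet X ∩ (N' ∩ orbitMap p ⁻¹' V), orbitMap p g = y := by
    intro y hy
    obtain ⟨g, ⟨hg, hgN⟩, rfl⟩ := hVsub hy
    exact ⟨g, ⟨hg, hgN, hy.2⟩, rfl⟩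
  refine ⟨N' ∩ orbitMap p ⁻¹' V, V, hN'o.inter (hV.preimage (hcont p)), ⟨hg₀N', hgV⟩, hV,
    fun g hg => ⟨⟨g, hg.1, rfl⟩, hg.2.2⟩, ?_, F, ?_, ?_, ?_, ?_⟩
  · exact fun g _ => ⟨univ, isOpen_univ, mem_univ _, _, (hsm p).contDiffOn, fun _ _ => rfl⟩
  · intro y hy
    obtain ⟨g, hg, rfl⟩ := hsurj y hy
    rw [hleft g ⟨hg.1, hg.2.1⟩]
    exact hg
  · intro y hy
    obtain ⟨g, hg, rfl⟩ := hsurj y hy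
    exact ⟨W', hW'o, hg.2.1.2, F, hFs, fun _ _ => rfl⟩
  · exact fun g hg => hleft g ⟨hg.1, hg.2.1⟩
  · intro y hy
    obtain ⟨g, hg, rfl⟩ := hsurj y hy
    rw [hleft g ⟨hg.1, hg.2.1⟩]

theorem continuous_orbitCLM : Continuous (orbitCLM : (S → X) → _) :=
  continuous_clm_apply.2 fun g => continuous_pi fun v => g.continuous.comp (continuous_apply v)

/-- If `f` is a smooth local section of the orbit map of `p`, then for `q` near `p` the map
`z ↦ z + (f z).q - (f z).p` is a local diffeomorphism at `p` sending `g.p` to `g.q`; composing `f`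
with its inverse gives a section of the orbit map of `q`. -/
theorem HasSmoothOrbitSection.eventually {p : S → X} (hp : HasSmoothOrbitSection p) :
    ∀ᶠ q in 𝓝 p, HasSmoothOrbitSection q := by
  obtain ⟨W, hW, hpW, f, hf, hev⟩ := hp
  have hfd : HasFDerivAt f (fderiv ℝ f p) p :=
    ((hf.contDiffAt (hW.mem_nhds hpW)).differentiableAt (by simp)).hasFDerivAt
  -- The derivative at `p` of the map `H` below: the identity when `q = p`, hence invertible for `q`
  -- near `p`.
  set D : (S → X) → ((S → X) →L[ℝ] (S → X)) := fun q =>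
    ContinuousLinearMap.id ℝ _ + (orbitCLM q - orbitCLM p).comp (fderiv ℝ f p) with hD
  have hDc : Continuous D :=
    continuous_const.add ((continuous_orbitCLM.sub continuous_const).clm_comp continuous_const)
  have hDp : IsUnit (D p) := by
    have : D p = 1 := by simp [hD]; rfl
    rw [this]; exact isUnit_one
  have hid : f p = ContinuousAffineMap.id ℝ X := by
    have := hev.self_of_nhdsWithin id_mem_isoSet
    rwa [orbitMap_id] at this
  filter_upwards [(Units.isOpen.preimage hDc).mem_nhds hDp] with q hq
  set H : (S → X) → (S → X) := fun z => z + (orbitCLM q - orbitCLM p) (f z) with hH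
  have hHs : ContDiffOn ℝ ∞ H W :=
    contDiffOn_id.add ((orbitCLM q - orbitCLM p).contDiff.comp_contDiffOn hf)
  have hHd : HasFDerivAt H (D q) p :=
    (hasFDerivAt_id p).add ((orbitCLM q - orbitCLM p).hasFDerivAt.comp p hfd)
  obtain ⟨V, hV, hHpV, G, hG, hGm, hGH⟩ :=
    exists_smooth_local_leftInverse hW hHs hpW (by rw [hHd.fderiv]; exact hq)
  have hHp : H p = q := by
    have : (orbitCLM q - orbitCLM p) (f p) = q - p := by
      rw [hid]; rfl
    rw [hH]; simp only [this]; abel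
  refine ⟨V, hV, hHp ▸ hHpV, f ∘ G, hf.comp hG hGm, ?_⟩
  have htend : Tendsto (orbitMap p) (𝓝[isoSet X] (ContinuousAffineMap.id ℝ X)) (𝓝 p) :=
    ((orbitCLM p).continuous.tendsto' _ _ (orbitMap_id p)).mono_left nhdsWithin_le_nhds
  filter_upwards [hev, htend.eventually hGH] with g hg hgG
  have h1 : H (orbitMap p g) = orbitMap q g := by
    have : (orbitCLM q - orbitCLM p) g = orbitMap q g - orbitMap p g := rfl
    rw [hH]; simp only [hg, this]; abel
  rw [Function.comp_apply, ← h1, hgG, hg]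

theorem isOpen_fullPlacements [Nonempty S] : IsOpen (fullPlacements S X) :=
  isOpen_iff_eventually.2 fun _ hp =>
    hp.hasSmoothOrbitSection.eventually.mono fun _ hq => hq.isFullPlacement

theorem hasSmoothOrbitSection_of_injective {p : S → X}
    (hp : Function.Injective (orbitMap (X := X) p)) : HasSmoothOrbitSection p := by
  obtain ⟨T, hT⟩ := (orbitCLM p : (X →ᴬ[ℝ] X) →ₗ[ℝ] (S → X)).exists_leftInverse_of_injective
    (LinearMap.ker_eq_bot.2 hp)
  exact ⟨univ, isOpen_univ, mem_univ _, T.toContinuousLinearMap,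
    T.toContinuousLinearMap.contDiff.contDiffOn,
    Eventually.of_forall fun g => LinearMap.congr_fun hT g⟩

omit [FiniteDimensional ℝ X] [Fintype S] in
/-- A placement whose difference vectors `p_{s i} - p_o` are the images of a basis under a
surjective linear map has injective orbit map. -/
theorem orbitMap_injective_of_surjective {ι : Type*} {p : S → X} (b : Module.Basis ι ℝ X)
    (M : X →ₗ[ℝ] X) (hM : Function.Surjective M) (o : S) (s : ι → S)
    (hp : ∀ i, M (b i) = p (s i) - p o) : Function.Injective (orbitMap (X := X) p) := by
  intro g h hgh
  have hv : ∀ v, g (p v) = h (p v) := fun v => congrFun hgh v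
  have hlin : (g.contLinear : X →ₗ[ℝ] X) ∘ₗ M = (h.contLinear : X →ₗ[ℝ] X) ∘ₗ M := by
    refine b.ext fun i => ?_
    have hg := g.contLinear_map_vsub (p (s i)) (p o)
    have hh := h.contLinear_map_vsub (p (s i)) (p o)
    simp only [vsub_eq_sub] at hg hh
    change g.contLinear (M (b i)) = h.contLinear (M (b i))
    rw [hp, hg, hh, hv, hv]
  have hlin' : ∀ x, g.contLinear x = h.contLinear x := fun x => by
    obtain ⟨y, rfl⟩ := hM x
    exact LinearMap.congr_fun hlin y
  ext x
  have hg := g.contLinear_map_vsub x (p o)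
  have hh := h.contLinear_map_vsub x (p o)
  simp only [vsub_eq_sub] at hg hh
  have := hlin' (x - p o)
  rw [hg, hh, hv o] at this
  exact sub_left_inj.1 this

theorem ae_mem_fullPlacements [MeasurableSpace X] [BorelSpace X]
    (hS : Module.finrank ℝ X + 1 ≤ Fintype.card S) (μ : MeasureTheory.Measure (S → X))
    [μ.IsAddHaarMeasure] : ∀ᵐ p ∂μ, p ∈ fullPlacements S X := by
  classical
  have : Nonempty S := Fintype.card_pos_iff.1 (by omega)
  have : ProperSpace X := FiniteDimensional.proper ℝ X
  obtain ⟨j⟩ : Nonempty (Option (Fin (Module.finrank ℝ X)) ↪ S) :=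
    Function.Embedding.nonempty_of_card_le (by simpa using hS)
  let b := Module.finBasis ℝ X
  -- Moving along `e` fixes the base point `j none` and adds `t • b i` to the `i`-th difference
  -- vector, so the matrix `M` of differences becomes `M + t • id`.
  let e : S → X := fun v => ∑ i, if v = j (some i) then b i else 0
  have he0 : e (j none) = 0 := by simp [e]
  have he (i) : e (j (some i)) = b i := by simp [e]
  refine MeasureTheory.ae_mem_of_ae_add_linearMap_mem (LinearMap.toSpanSingleton ℝ (S → X) e)
    MeasureTheory.volume μ isOpen_fullPlacements.measurableSet fun y => ?_
  let M : Module.End ℝ X := b.constr ℝ fun i => y (j (some i)) - y (j none)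
  have hM (i) : M (b i) = y (j (some i)) - y (j none) := b.constr_basis _ _ _
  -- `M + t • id` is singular exactly when `-t` is an eigenvalue of `M`.
  have hfin : {t : ℝ | M.HasEigenvalue (-t)}.Finite :=
    (Module.End.finite_hasEigenvalue M).preimage neg_injective.injOn
  filter_upwards [hfin.countable.ae_notMem MeasureTheory.volume] with t ht
  refine (hasSmoothOrbitSection_of_injective (orbitMap_injective_of_surjective b
    (M + t • LinearMap.id) (LinearMap.injective_iff_surjective.1 ?_) (j none)
    (fun i => j (some i)) fun i => ?_)).isFullPlacement
  · refine (injective_iff_map_eq_zero _).2 fun x hx => ?_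
    by_contra hx0
    refine ht (Module.End.hasEigenvalue_of_hasEigenvector (x := x) ⟨?_, hx0⟩)
    rw [Module.End.mem_eigenspace_iff, neg_smul]
    exact eq_neg_of_add_eq_zero_left hx
  · simp [hM, he, he0]
    abel

end Sections

theorem mainTheorem7 {X : Type*} [NormedAddCommGroup X] [NormedSpace ℝ X]
    [FiniteDimensional ℝ X] [MeasurableSpace X] [BorelSpace X]
    {S : Type*} [Fintype S] (hS : Module.finrank ℝ X + 1 ≤ Fintype.card S) :
    IsOpen (fullPlacements S X) ∧ Dense (fullPlacements S X) ∧
      ∀ μ : MeasureTheory.Measure (S → X), μ.IsAddHaarMeasure →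
        μ (fullPlacements S X)ᶜ = 0 := by
  have : Nonempty S := Fintype.card_pos_iff.1 (by omega)
  have : ProperSpace X := FiniteDimensional.proper ℝ X
  exact ⟨isOpen_fullPlacements,
    MeasureTheory.Measure.dense_of_ae
      (ae_mem_fullPlacements hS (MeasureTheory.Measure.addHaar : MeasureTheory.Measure (S → X))),
    fun μ hμ => MeasureTheory.mem_ae_iff.1 (ae_mem_fullPlacements hS μ)⟩
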